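/- Let $n\ge 1$ and let $p,\alpha$ be real numbers such that either $p>1$ and $0<\alpha<\frac{n+2}{2p}$, or $p=1$ and $0<\alpha\le\frac{n+2}{2}$. Put $$\Phi_\alpha(x,t)=\frac{t^{\alpha-1}}{\Gamma(\alpha)}\,\frac{1}{(4\pi t)^{n/2}}\,e^{-|x|^2/(4t)}\ \text{ for } t>0,\qquad \Phi_\alpha(x,t)=0\ \text{ for } t\le 0,\qquad (x,t)\in\mathbb R^n\times\mathbb R .$$ Let $X^p$ be the space of measurable functions $f:\mathbb R^n\times\mathbb R\to\mathbb R$ (functions equal almost everywhere being identified) with $f\in L^p(\mathbb R^n\times(-\infty,T))$ for every $T\in\mathbb R$. For $f\in X^p$ let $$J_\alpha f(x,t)=\iint_{\mathbb R^n\times(-\infty,t)}\Phi_\alpha(x-\xi,t-\tau)\,f(\xi,\tau)\,d\xi\,d\tau ,$$ and let $Y^p_\alpha=J_\alpha(X^p)$, functions equal almost everywhere being identified again. Then, for every $f\in X^p$, the integral defining $J_\alpha f(x,t)$ converges absolutely for almost every $(x,t)\in\mathbb R^n\times\mathbb R$, and: (i) the operator $J_\alpha:X^p\to Y^p_\alpha$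 is one-to-one and onto; (ii) for all $f\in X^p$ and $T\in\mathbb R$, $f=0$ almost everywhere in $\mathbb R^n\times(-\infty,T)$ if and only if $J_\alpha f=0$ almost everywhere in $\mathbb R^n\times(-\infty,T)$. Consequently $J_\alpha:X^p\to Y^p_\alpha$ has a unique two-sided inverse $(\partial_t-\Delta)^\alpha:Y^p_\alpha\to X^p$. -/

import Mathlib

open MeasureTheory Set

namespace FracHeat

/-- Space-time `ℝⁿ × ℝ`, with Lebesgue measure `volume`. -/
abbrev SpaceTime (n : ℕ) : Type := EuclideanSpace ℝ (Fin n) × ℝ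

/-- The slab `ℝⁿ × (-∞, T)`. -/
def slab (n : ℕ) (T : ℝ) : Set (SpaceTime n) := univ ×ˢ Iio T

/-- The kernel `Φ_α(x,t) = t^(α-1)/Γ(α) · (4πt)^(-n/2) · exp(-|x|²/(4t))` for `t > 0`,
and `0` for `t ≤ 0`. -/
noncomputable def Phi (n : ℕ) (α : ℝ) (x : EuclideanSpace ℝ (Fin n)) (t : ℝ) : ℝ :=
  if 0 < t then
    t ^ (α - 1) / Real.Gamma α * (1 / (4 * Real.pi * t) ^ ((n : ℝ) / 2)) *
      Real.exp (-‖x‖ ^ 2 / (4 * t))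
  else 0

/-- The function `J_α f(x,t) = ∬_{ℝⁿ × (-∞,t)} Φ_α(x-ξ, t-τ) f(ξ,τ) dξ dτ`
(with the value `0` at points where the integral does not converge absolutely). -/
noncomputable def potential (n : ℕ) (α : ℝ) (f : SpaceTime n → ℝ) (z : SpaceTime n) : ℝ :=
  ∫ w in slab n z.2, Phi n α (z.1 - w.1) (z.2 - w.2) * f w

/-- `X^p`: the space of measurable functions on `ℝⁿ × ℝ`, up to equality almost everywhere,
which lie in `L^p(ℝⁿ × (-∞,T))` for every real `T`. -/
noncomputable def X (n : ℕ) (p : ℝ) : Submodule ℝ (SpaceTime n →ₘ[volume] ℝ) where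
  carrier := {f | ∀ T : ℝ, MemLp f (ENNReal.ofReal p) (volume.restrict (slab n T))}
  zero_mem' := fun T => by
    refine (memLp_congr_ae (ae_restrict_of_ae AEEqFun.coeFn_zero)).2 ?_
    exact MemLp.zero
  add_mem' := fun {f g} hf hg T =>
    (memLp_congr_ae (ae_restrict_of_ae (AEEqFun.coeFn_add f g))).2 ((hf T).add (hg T))
  smul_mem' := fun c f hf T =>
    (memLp_congr_ae (ae_restrict_of_ae (AEEqFun.coeFn_smul c f))).2 ((hf T).const_smul c)

theorem measurable_Phi (n : ℕ) (α : ℝ) :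
    Measurable (fun q : SpaceTime n => Phi n α q.1 q.2) := by
  unfold Phi
  refine Measurable.ite (measurableSet_lt measurable_const measurable_snd) ?_ measurable_const
  fun_prop

theorem potential_eq_integral (n : ℕ) (α : ℝ) (f : SpaceTime n → ℝ) (z : SpaceTime n) :
    potential n α f z = ∫ w, Phi n α (z.1 - w.1) (z.2 - w.2) * f w := by
  unfold potential
  refine setIntegral_eq_integral_of_forall_compl_eq_zero fun w hw => ?_
  have h : ¬ 0 < z.2 - w.2 := fun h => hw ⟨mem_univ _, by simpa using h⟩
  simp [Phi, h]

theorem stronglyMeasurable_potential (n : ℕ) (α : ℝ) {f : SpaceTime n → ℝ}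
    (hf : StronglyMeasurable f) : StronglyMeasurable (potential n α f) := by
  have h : potential n α f =
      fun z => ∫ w, (fun q : SpaceTime n × SpaceTime n =>
        Phi n α (q.1 - q.2).1 (q.1 - q.2).2 * f q.2) (z, w) :=
    funext fun z => potential_eq_integral n α f z
  rw [h]
  have hm : StronglyMeasurable (fun q : SpaceTime n × SpaceTime n =>
      Phi n α (q.1 - q.2).1 (q.1 - q.2).2 * f q.2) :=
    (((measurable_Phi n α).comp (measurable_fst.sub measurable_snd)).mul
      (hf.measurable.comp measurable_snd)).stronglyMeasurable
  exact hm.integral_prod_right' (ν := volume)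

/-- The operator `J_α` on `X^p`, with values in the measurable functions on `ℝⁿ × ℝ`
up to equality almost everywhere. -/
noncomputable def J (n : ℕ) (p α : ℝ) (f : X n p) : SpaceTime n →ₘ[volume] ℝ :=
  AEEqFun.mk (potential n α (f : SpaceTime n →ₘ[volume] ℝ))
    (stronglyMeasurable_potential n α
      (AEEqFun.stronglyMeasurable (f : SpaceTime n →ₘ[volume] ℝ))).aestronglyMeasurable

/-- `Y^p_α = J_α(X^p)`. -/
def Y (n : ℕ) (p α : ℝ) : Set (SpaceTime n →ₘ[volume] ℝ) := range (J n p α)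

/-- The operator `J_α : X^p → Y^p_α`. -/
noncomputable def JXY (n : ℕ) (p α : ℝ) (f : X n p) : Y n p α := ⟨J n p α f, f, rfl⟩

/-- A class of measurable functions on `ℝⁿ × ℝ` vanishes (almost everywhere) in
`ℝⁿ × (-∞,T)`. -/
def VanishesBefore {n : ℕ} (T : ℝ) (u : SpaceTime n →ₘ[volume] ℝ) : Prop :=
  ∀ᵐ z ∂(volume.restrict (slab n T)), u z = 0

end FracHeat

/-! `J_α` is space-time convolution with `a(s) · heat s x` for `a = rlKernel α`. Up to time `T` it
sees only `f` below `T`, so `f` may be truncated to a function in `L^p` of the whole space. Both (i)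
and (ii) then reduce to one uniqueness statement, `ae_eq_zero_of_convolution_eq_zero`: if `K_α ⋆ f =
0` before `T`, then `f = 0` before `T`.

By the heat semigroup law, `a ↦ subKernel n a` turns convolution on the half-line into convolution
on space-time (`convolution_subKernel`). A test function `g` on `(0,∞)` factors as `g = rlKernel α ⋆
a`, with `a` its Riemann–Liouville derivative of order `α`: continuous, integrable and causal. Hence
`subKernel g ⋆ f = subKernel a ⋆ (K_α ⋆ f)`, which vanishes before `T` because it involves only
earlier times. Testing against `φ` supported in the slab and letting `g` concentrate near time `0`,
where the heat kernel is an approximate identity, gives `∫ φ f = 0`.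

Convergence and associativity rest on `exists_lintegral_subKernel_mul_le`, the only place where the
range of `α` matters: the kernel for `s ≤ 1` is integrable, and its tail is in the dual space of
`L^p`. -/

namespace FracHeat

open Filter Topology Convolution ContinuousLinearMap
open scoped ENNReal

/-! ### Riemann–Liouville kernels and fractional integration on the half-line. -/

/-- The Riemann–Liouville kernel `s^(a-1)/Γ(a)` on `(0,∞)`, extended by zero. -/
noncomputable def rlKernel (a s : ℝ) : ℝ := if 0 < s then s ^ (a - 1) / Real.Gamma a else 0

theorem rlKernel_of_pos {a s : ℝ} (hs : 0 < s) : rlKernel a s = s ^ (a - 1) / Real.Gamma a :=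
  if_pos hs

theorem rlKernel_of_nonpos {a s : ℝ} (hs : s ≤ 0) : rlKernel a s = 0 := if_neg hs.not_gt

theorem rlKernel_nonneg {a : ℝ} (ha : 0 < a) (s : ℝ) : 0 ≤ rlKernel a s := by
  unfold rlKernel
  split_ifs with h
  · have := Real.Gamma_pos_of_pos ha
    positivity
  · exact le_rfl

theorem measurable_rlKernel (a : ℝ) : Measurable (rlKernel a) := by
  unfold rlKernel
  refine Measurable.ite (measurableSet_lt measurable_const measurable_id) ?_ measurable_const
  fun_prop

theorem integral_rpow_mul_sub_rpow {a b s : ℝ} (ha : 0 < a) (hb : 0 < b) (hs : 0 < s) :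
    ∫ t in Ioo 0 s, t ^ (a - 1) * (s - t) ^ (b - 1) =
      s ^ (a + b - 1) * (Real.Gamma a * Real.Gamma b / Real.Gamma (a + b)) := by
  have h := Complex.betaIntegral_scaled a b hs
  have hB : Complex.betaIntegral a b =
      ((Real.Gamma a * Real.Gamma b / Real.Gamma (a + b) : ℝ) : ℂ) := by
    rw [Complex.betaIntegral_eq_Gamma_mul_div _ _ (by simpa) (by simpa), ← Complex.ofReal_add]
    simp_rw [Complex.Gamma_ofReal]
    norm_cast
  rw [hB, intervalIntegral.integral_of_le hs.le, integral_Ioc_eq_integral_Ioo] at h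
  have h2 : ∫ t in Ioo 0 s, (t : ℂ) ^ ((a : ℂ) - 1) * ((s : ℂ) - t) ^ ((b : ℂ) - 1) =
      ∫ t in Ioo 0 s, ((t ^ (a - 1) * (s - t) ^ (b - 1) : ℝ) : ℂ) := by
    refine setIntegral_congr_fun measurableSet_Ioo fun t ht => ?_
    simp only [Complex.ofReal_mul]
    rw [Complex.ofReal_cpow ht.1.le, Complex.ofReal_cpow (sub_nonneg.2 ht.2.le)]
    push_cast
    rfl
  rw [h2, integral_complex_ofReal] at h
  have h3 : ((s : ℂ) ^ ((a : ℂ) + b - 1)) = ((s ^ (a + b - 1) : ℝ) : ℂ) := by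
    rw [Complex.ofReal_cpow hs.le]
    push_cast
    rfl
  rw [h3] at h
  exact_mod_cast h

theorem rlKernel_mul_eq_indicator (a b s : ℝ) :
    (fun t => rlKernel a t * rlKernel b (s - t)) = (Ioo 0 s).indicator fun t =>
      (t ^ (a - 1) * (s - t) ^ (b - 1)) * (Real.Gamma a * Real.Gamma b)⁻¹ := by
  ext t
  by_cases ht : t ∈ Ioo 0 s
  · rw [indicator_of_mem ht, rlKernel_of_pos ht.1, rlKernel_of_pos (sub_pos.2 ht.2)]
    field_simp
  · rw [indicator_of_notMem ht]
    by_cases h0 : 0 < t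
    · rw [rlKernel_of_nonpos (s := s - t) (by by_contra! h; exact ht ⟨h0, by linarith⟩), mul_zero]
    · rw [rlKernel_of_nonpos (not_lt.1 h0), zero_mul]

theorem integral_rlKernel_mul {a b : ℝ} (ha : 0 < a) (hb : 0 < b) (s : ℝ) :
    ∫ t, rlKernel a t * rlKernel b (s - t) = rlKernel (a + b) s := by
  rw [rlKernel_mul_eq_indicator, integral_indicator measurableSet_Ioo, integral_mul_const]
  rcases le_or_gt s 0 with hs | hs
  · simp [Ioo_eq_empty_of_le hs, rlKernel_of_nonpos hs]
  · rw [integral_rpow_mul_sub_rpow ha hb hs, rlKernel_of_pos hs]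
    have := Real.Gamma_pos_of_pos ha
    have := Real.Gamma_pos_of_pos hb
    field_simp

theorem convolution_rlKernel {a b : ℝ} (ha : 0 < a) (hb : 0 < b) :
    rlKernel a ⋆[mul ℝ ℝ, volume] rlKernel b = rlKernel (a + b) :=
  funext fun s => by rw [convolution_mul, integral_rlKernel_mul ha hb]

theorem convolutionExists_rlKernel {a b : ℝ} (ha : 0 < a) (hb : 0 < b) :
    ConvolutionExists (rlKernel a) (rlKernel b) (mul ℝ ℝ) volume := by
  intro s
  rcases le_or_gt s 0 with hs | hs
  · refine (integrable_zero ℝ ℝ volume).congr (Eventually.of_forall fun t => ?_)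
    have := congrFun (rlKernel_mul_eq_indicator a b s) t
    simp only [Ioo_eq_empty_of_le hs, indicator_empty] at this
    exact this.symm
  -- The Bochner integral of a non-integrable function is `0`, so the positive value found by the
  -- beta integral proves integrability.
  · refine Integrable.of_integral_ne_zero ?_
    have := integral_rlKernel_mul ha hb s
    simp only [mul_apply']
    rw [this, rlKernel_of_pos hs]
    have := Real.Gamma_pos_of_pos (add_pos ha hb)
    positivity

theorem integrableOn_rlKernel {a : ℝ} (ha : 0 < a) (B : ℝ) :
    IntegrableOn (rlKernel a) (Iic B) := by
  rcases le_or_gt B 0 with hB | hB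
  · exact integrableOn_zero.congr_fun (fun t ht => (rlKernel_of_nonpos (le_trans ht hB)).symm)
      measurableSet_Iic
  rw [← Iic_union_Ioc_eq_Iic hB.le]
  refine IntegrableOn.union (integrableOn_zero.congr_fun
    (fun t ht => (rlKernel_of_nonpos ht).symm) measurableSet_Iic) ?_
  have h := (intervalIntegral.intervalIntegrable_rpow' (a := 0) (b := B)
    (by linarith : -1 < a - 1)).div_const (Real.Gamma a)
  rw [intervalIntegrable_iff_integrableOn_Ioc_of_le hB.le] at h
  exact h.congr_fun (fun t ht => (rlKernel_of_pos ht.1).symm) measurableSet_Ioc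

theorem locallyIntegrable_rlKernel {a : ℝ} (ha : 0 < a) : LocallyIntegrable (rlKernel a) :=
  fun x => ⟨Iic (x + 1), Iic_mem_nhds (by linarith), integrableOn_rlKernel ha _⟩

theorem convolution_rlKernel_eq_zero {a : ℝ} {v : ℝ → ℝ} (hv : ∀ t ≤ 0, v t = 0) {x : ℝ}
    (hx : x ≤ 0) : (rlKernel a ⋆[mul ℝ ℝ, volume] v) x = 0 := by
  rw [convolution_mul]
  refine integral_eq_zero_of_ae (Eventually.of_forall fun t => ?_)
  rcases le_or_gt t 0 with h | h
  · simp [rlKernel_of_nonpos h]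
  · simp [hv (x - t) (by linarith)]

theorem integrable_rlKernel_mul {a : ℝ} (ha : 0 < a) {w : ℝ → ℝ} (hw : Continuous w)
    (hw0 : ∀ t ≤ 0, w t = 0) (x : ℝ) : Integrable fun t => rlKernel a t * w (x - t) := by
  have h1 : IntegrableOn (fun t => rlKernel a t * w (x - t)) (Icc 0 x) :=
    ((integrableOn_rlKernel ha x).mono_set Icc_subset_Iic_self).mul_continuousOn
      (by fun_prop) isCompact_Icc
  refine (integrableOn_iff_integrable_of_support_subset fun t ht => ?_).1 h1
  by_contra h
  apply ht
  by_cases h0 : 0 ≤ t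
  · simp [hw0 (x - t) (by by_contra! h2; exact h ⟨h0, by linarith⟩)]
  · simp [rlKernel_of_nonpos (not_le.1 h0).le]

theorem convolution_rlKernel_convolution {a b : ℝ} (ha : 0 < a) (hb : 0 < b) {v : ℝ → ℝ}
    (hv : Continuous v) (hvc : HasCompactSupport v) (hv0 : ∀ t ≤ 0, v t = 0) :
    rlKernel a ⋆[mul ℝ ℝ, volume] (rlKernel b ⋆[mul ℝ ℝ, volume] v) =
      rlKernel (a + b) ⋆[mul ℝ ℝ, volume] v := by
  have hn : ∀ {c : ℝ}, 0 < c → (fun x => ‖rlKernel c x‖) = rlKernel c := fun hc =>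
    funext fun x => Real.norm_of_nonneg (rlKernel_nonneg hc x)
  rw [← convolution_rlKernel ha hb]
  ext x
  refine (convolution_assoc (mul ℝ ℝ) (mul ℝ ℝ) (mul ℝ ℝ) (mul ℝ ℝ) (fun x y z => mul_assoc x y z)
    (measurable_rlKernel a).aestronglyMeasurable (measurable_rlKernel b).aestronglyMeasurable
    hv.aestronglyMeasurable (Eventually.of_forall (convolutionExists_rlKernel ha hb))
    (Eventually.of_forall ?_) ?_).symm
  · rw [hn hb]
    exact hvc.norm.convolutionExists_right (mul ℝ ℝ) (locallyIntegrable_rlKernel hb) hv.norm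
  · rw [hn ha, hn hb]
    refine integrable_rlKernel_mul ha ?_ (fun t ht => ?_) x
    · exact hvc.norm.continuous_convolution_right (mul ℝ ℝ) (locallyIntegrable_rlKernel hb) hv.norm
    · exact convolution_rlKernel_eq_zero (fun t ht => by simp [hv0 t ht]) ht

theorem rlKernel_one_convolution_deriv {v : ℝ → ℝ} (hv : ContDiff ℝ 1 v)
    (hvc : HasCompactSupport v) : rlKernel 1 ⋆[mul ℝ ℝ, volume] deriv v = v := by
  ext x
  rw [convolution_mul_swap, ← HasCompactSupport.integral_Iic_deriv_eq hv hvc x,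
    integral_Iic_eq_integral_Iio, ← integral_indicator measurableSet_Iio]
  congr 1
  ext t
  by_cases ht : t < x
  · rw [indicator_of_mem (mem_Iio.2 ht), rlKernel_of_pos (sub_pos.2 ht)]
    simp
  · rw [indicator_of_notMem (by simpa using ht), rlKernel_of_nonpos (by linarith), zero_mul]

theorem hasCompactSupport_iteratedDeriv {g : ℝ → ℝ} (hgc : HasCompactSupport g) (m : ℕ) :
    HasCompactSupport (iteratedDeriv m g) := by
  induction m with
  | zero => simpa using hgc
  | succ m ih => rw [iteratedDeriv_succ]; exact ih.deriv

theorem tsupport_iteratedDeriv_subset (g : ℝ → ℝ) (m : ℕ) :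
    tsupport (iteratedDeriv m g) ⊆ tsupport g := by
  induction m with
  | zero => simp
  | succ m ih =>
    rw [iteratedDeriv_succ]
    exact (closure_minimal (support_deriv_subset) (isClosed_tsupport _)).trans ih

theorem contDiff_iteratedDeriv {g : ℝ → ℝ} (hg : ContDiff ℝ (⊤ : ℕ∞) g) (m : ℕ) :
    ContDiff ℝ (⊤ : ℕ∞) (iteratedDeriv m g) := by
  rw [iteratedDeriv_eq_iterate]
  exact ContDiff.iterate_deriv m hg

/-- Convolution with `rlKernel 1` is integration from `-∞`; `m + 1` such integrations undo `m + 1`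
derivatives. -/
theorem rlKernel_convolution_iteratedDeriv {g : ℝ → ℝ} (hg : ContDiff ℝ (⊤ : ℕ∞) g)
    (hgc : HasCompactSupport g) (hg0 : tsupport g ⊆ Ioi 0) (m : ℕ) :
    rlKernel (m + 1) ⋆[mul ℝ ℝ, volume] iteratedDeriv (m + 1) g = g := by
  have key (m : ℕ) : rlKernel 1 ⋆[mul ℝ ℝ, volume] iteratedDeriv (m + 1) g =
      iteratedDeriv m g := by
    rw [iteratedDeriv_succ]
    exact rlKernel_one_convolution_deriv ((contDiff_iteratedDeriv hg m).of_le (by norm_cast))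
      (hasCompactSupport_iteratedDeriv hgc m)
  induction m with
  | zero => simpa using key 0
  | succ m ih =>
    have h := convolution_rlKernel_convolution (a := m + 1) (b := 1) (by positivity) one_pos
      (contDiff_iteratedDeriv hg (m + 2)).continuous (hasCompactSupport_iteratedDeriv hgc (m + 2))
      (fun t ht => by
        by_contra h
        exact absurd (hg0 (tsupport_iteratedDeriv_subset g _ (subset_tsupport _ h)))
          (not_lt.2 ht))
    rw [key (m + 1), ih] at h
    push_cast
    exact h.symm

/-! ### Fractional derivatives of test functions and their decay. -/

theorem integrable_sub_rpow_mul {v : ℝ → ℝ} (hv : Continuous v) (hvc : HasCompactSupport v)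
    {s : ℝ} (hs : tsupport v ⊆ Iio s) (γ : ℝ) : Integrable fun r => (s - r) ^ γ * v r := by
  have h : IntegrableOn (fun r => (s - r) ^ γ * v r) (tsupport v) := by
    refine ContinuousOn.integrableOn_compact hvc ?_
    refine ContinuousOn.mul (ContinuousOn.rpow_const (by fun_prop) fun r hr => Or.inl ?_)
      hv.continuousOn
    exact (sub_pos.2 (hs hr)).ne'
  refine (integrableOn_iff_integrable_of_support_subset fun r hr => ?_).1 h
  exact subset_tsupport _ (fun h => hr (by simp [h]))

theorem integral_sub_rpow_mul_deriv {v : ℝ → ℝ} (hv : ContDiff ℝ 1 v) (hvc : HasCompactSupport v)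
    {s : ℝ} (hs : tsupport v ⊆ Iio s) (γ : ℝ) :
    ∫ r, (s - r) ^ γ * deriv v r = γ * ∫ r, (s - r) ^ (γ - 1) * v r := by
  have hd : Continuous (deriv v) := hv.continuous_deriv le_rfl
  have hi := integrable_sub_rpow_mul hv.continuous hvc hs (γ - 1)
  have h := integral_mul_deriv_eq_deriv_mul_of_integrable (u := fun r => (s - r) ^ γ) (v := v)
    (u' := fun r => -(γ * (s - r) ^ (γ - 1))) (v' := deriv v) ?_ ?_ ?_ ?_ ?_
  · rw [h, ← integral_neg, ← integral_const_mul]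
    congr 1
    ext r
    ring
  · intro r hr
    have h1 : HasDerivAt (fun r => s - r) (-1) r := by
      simpa using (hasDerivAt_id r).const_sub s
    convert! h1.rpow_const (p := γ) (Or.inl (sub_pos.2 (hs hr)).ne') using 1
    ring
  · intro r _
    exact (hv.differentiable one_ne_zero r).hasDerivAt
  · exact integrable_sub_rpow_mul hd hvc.deriv
      ((closure_minimal (support_deriv_subset) (isClosed_tsupport _)).trans hs) γ
  · refine (hi.const_mul (-γ)).congr (Eventually.of_forall fun r => ?_)
    simp only [Pi.mul_apply]
    ring
  · exact integrable_sub_rpow_mul hv.continuous hvc hs γ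

/-- Integration by parts `m` times, with `s` beyond the support so that the power is smooth there.
For decay estimates it matters only that `c` is independent of `s`. -/
theorem exists_integral_sub_rpow_mul_iteratedDeriv {g : ℝ → ℝ} (hg : ContDiff ℝ (⊤ : ℕ∞) g)
    (hgc : HasCompactSupport g) (m : ℕ) (γ : ℝ) :
    ∃ c : ℝ, ∀ s, tsupport g ⊆ Iio s →
      ∫ r, (s - r) ^ γ * iteratedDeriv m g r = c * ∫ r, (s - r) ^ (γ - m) * g r := by
  induction m generalizing γ with
  | zero => exact ⟨1, fun s _ => by simp⟩
  | succ m ih =>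
    obtain ⟨c, hc⟩ := ih (γ - 1)
    refine ⟨γ * c, fun s hs => ?_⟩
    rw [iteratedDeriv_succ, integral_sub_rpow_mul_deriv
      ((contDiff_iteratedDeriv hg m).of_le (by norm_cast))
      (hasCompactSupport_iteratedDeriv hgc m) ((tsupport_iteratedDeriv_subset g m).trans hs),
      hc s hs, mul_assoc]
    push_cast
    ring_nf

/-- The Riemann–Liouville derivative of order `m - b`, with `m` an integer, of a test function on
`(0,∞)`. -/
noncomputable def rlDeriv (m : ℕ) (b : ℝ) (g : ℝ → ℝ) : ℝ → ℝ :=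
  rlKernel b ⋆[mul ℝ ℝ, volume] iteratedDeriv m g

section RLDeriv

variable {g : ℝ → ℝ}

theorem iteratedDeriv_eq_zero_of_nonpos (hg0 : tsupport g ⊆ Ioi 0) (m : ℕ) {t : ℝ} (ht : t ≤ 0) :
    iteratedDeriv m g t = 0 := by
  by_contra h
  exact absurd (hg0 (tsupport_iteratedDeriv_subset g _ (subset_tsupport _ h))) (not_lt.2 ht)

theorem rlDeriv_eq_zero_of_nonpos (hg0 : tsupport g ⊆ Ioi 0) (m : ℕ) (b : ℝ) {t : ℝ}
    (ht : t ≤ 0) : rlDeriv m b g t = 0 :=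
  convolution_rlKernel_eq_zero (fun _ h => iteratedDeriv_eq_zero_of_nonpos hg0 m h) ht

theorem continuous_rlDeriv (hg : ContDiff ℝ (⊤ : ℕ∞) g) (hgc : HasCompactSupport g)
    (m : ℕ) {b : ℝ} (hb : 0 < b) : Continuous (rlDeriv m b g) :=
  (hasCompactSupport_iteratedDeriv hgc m).continuous_convolution_right (mul ℝ ℝ)
    (locallyIntegrable_rlKernel hb) (contDiff_iteratedDeriv hg m).continuous

/-- By the semigroup law the two fractional integrations add up to the integer order `m + 1`, which
undoes the derivatives. -/
theorem rlKernel_convolution_rlDeriv (hg : ContDiff ℝ (⊤ : ℕ∞) g)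
    (hgc : HasCompactSupport g) (hg0 : tsupport g ⊆ Ioi 0) {m : ℕ} {a b : ℝ} (ha : 0 < a)
    (hb : 0 < b) (hab : a + b = m + 1) :
    rlKernel a ⋆[mul ℝ ℝ, volume] rlDeriv (m + 1) b g = g := by
  rw [rlDeriv, convolution_rlKernel_convolution ha hb (contDiff_iteratedDeriv hg _).continuous
    (hasCompactSupport_iteratedDeriv hgc _) (fun t ht => iteratedDeriv_eq_zero_of_nonpos hg0 _ ht),
    hab, rlKernel_convolution_iteratedDeriv hg hgc hg0]

theorem exists_abs_rlDeriv_le (hg : ContDiff ℝ (⊤ : ℕ∞) g)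
    (hgc : HasCompactSupport g) {m : ℕ} {b : ℝ} (hbm : b ≤ m + 1) :
    ∃ C R : ℝ, 0 < R ∧ ∀ s, R < s → |rlDeriv m b g s| ≤ C * s ^ (b - 1 - m) := by
  obtain ⟨c, hc⟩ := exists_integral_sub_rpow_mul_iteratedDeriv hg hgc m (b - 1)
  obtain ⟨R, hR⟩ := hgc.isCompact.bddAbove
  set R' := max R 1
  have hR1 : 0 < R' := lt_max_of_lt_right one_pos
  have hRR : ∀ r ∈ tsupport g, r ≤ R' := fun r hr => (hR hr).trans (le_max_left _ _)
  have hgi : Integrable g := hg.continuous.integrable_of_hasCompactSupport hgc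
  -- For `s > 2R'` and `r` in the support, `s - r ≥ s / 2`; the exponent `b - 1 - m` is nonpositive,
  -- whence the factor `(1 / 2) ^ (b - 1 - m)`.
  refine ⟨|c| * ((1 / 2) ^ (b - 1 - m) * ∫ r, |g r|) * |(Real.Gamma b)⁻¹|, 2 * R', by positivity,
    fun s hs => ?_⟩
  have hts : tsupport g ⊆ Iio s := fun r hr => by
    have := hRR r hr
    simp only [mem_Iio]; linarith
  have h1 : rlDeriv m b g s =
      (∫ r, (s - r) ^ (b - 1) * iteratedDeriv m g r) * (Real.Gamma b)⁻¹ := by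
    rw [rlDeriv, convolution_mul_swap, ← integral_mul_const]
    congr 1
    ext r
    by_cases hr : r ∈ tsupport g
    · rw [rlKernel_of_pos (sub_pos.2 (hts hr))]
      ring
    · have : iteratedDeriv m g r = 0 := by
        by_contra h
        exact hr (tsupport_iteratedDeriv_subset g m (subset_tsupport _ h))
      simp [this]
  have h2 : |∫ r, (s - r) ^ (b - 1 - m) * g r| ≤
      (1 / 2) ^ (b - 1 - m) * s ^ (b - 1 - m) * ∫ r, |g r| := by
    rw [← integral_const_mul]
    rw [← Real.norm_eq_abs]
    refine norm_integral_le_of_norm_le (hgi.abs.const_mul _) (Eventually.of_forall fun r => ?_)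
    by_cases hr : r ∈ tsupport g
    · rw [norm_mul, Real.norm_eq_abs, Real.norm_eq_abs]
      refine mul_le_mul_of_nonneg_right ?_ (abs_nonneg _)
      have := hRR r hr
      rw [abs_of_nonneg (Real.rpow_nonneg (by linarith) _),
        ← Real.mul_rpow (by norm_num) (by linarith)]
      exact Real.rpow_le_rpow_of_nonpos (by linarith) (by linarith) (by linarith)
    · simp [image_eq_zero_of_notMem_tsupport hr]
  rw [h1, hc s hts, abs_mul, abs_mul]
  calc |c| * |∫ r, (s - r) ^ (b - 1 - m) * g r| * |(Real.Gamma b)⁻¹|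
      ≤ |c| * ((1 / 2) ^ (b - 1 - m) * s ^ (b - 1 - m) * ∫ r, |g r|) * |(Real.Gamma b)⁻¹| := by
        gcongr
    _ = _ := by ring

theorem integrable_rlDeriv (hg : ContDiff ℝ (⊤ : ℕ∞) g) (hgc : HasCompactSupport g)
    (hg0 : tsupport g ⊆ Ioi 0) {m : ℕ} {b : ℝ} (hb : 0 < b) (hbm : b < m) :
    Integrable (rlDeriv m b g) := by
  obtain ⟨C, R, hR, h⟩ := exists_abs_rlDeriv_le hg hgc (m := m) (b := b) (by linarith)
  have hcont := continuous_rlDeriv hg hgc m hb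
  have h1 : IntegrableOn (rlDeriv m b g) (Iic 0) :=
    integrableOn_zero.congr_fun (fun t ht => (rlDeriv_eq_zero_of_nonpos hg0 m b ht).symm)
      measurableSet_Iic
  have h2 : IntegrableOn (rlDeriv m b g) (Ioc 0 R) :=
    (hcont.continuousOn.integrableOn_compact isCompact_Icc).mono_set Ioc_subset_Icc_self
  have h3 : IntegrableOn (rlDeriv m b g) (Ioi R) := by
    refine Integrable.mono' ((integrableOn_Ioi_rpow_of_lt
      (show b - 1 - m < -1 by linarith) hR).const_mul C) hcont.aestronglyMeasurable ?_
    filter_upwards [ae_restrict_mem measurableSet_Ioi] with s hs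
    exact h s hs
  have h4 := (h1.union h2).union h3
  rwa [Iic_union_Ioc_eq_Iic hR.le, Iic_union_Ioi, integrableOn_univ] at h4

end RLDeriv

/-! ### The heat kernel and its semigroup law. -/

variable {n : ℕ}

instance : (volume : Measure (SpaceTime n)).IsAddHaarMeasure :=
  inferInstanceAs ((volume : Measure (EuclideanSpace ℝ (Fin n))).prod
    (volume : Measure ℝ)).IsAddHaarMeasure

/-- The Gauss–Weierstrass kernel at time `s`. -/
noncomputable def heat (s : ℝ) (x : EuclideanSpace ℝ (Fin n)) : ℝ :=
  ((4 * Real.pi * s) ^ ((n : ℝ) / 2))⁻¹ * Real.exp (-(1 / (4 * s)) * ‖x‖ ^ 2)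

theorem measurable_heat :
    Measurable fun z : SpaceTime n => heat z.2 z.1 := by
  unfold heat
  fun_prop

theorem heat_nonneg {s : ℝ} (hs : 0 ≤ s) (x : EuclideanSpace ℝ (Fin n)) : 0 ≤ heat s x := by
  unfold heat
  have := Real.pi_pos
  positivity

theorem heat_pos {s : ℝ} (hs : 0 < s) (x : EuclideanSpace ℝ (Fin n)) : 0 < heat s x := by
  unfold heat
  have := Real.pi_pos
  positivity

theorem heat_le {s : ℝ} (hs : 0 ≤ s) (x : EuclideanSpace ℝ (Fin n)) :
    heat s x ≤ ((4 * Real.pi * s) ^ ((n : ℝ) / 2))⁻¹ := by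
  unfold heat
  have := Real.pi_pos
  refine mul_le_of_le_one_right (by positivity) (Real.exp_le_one_iff.2 ?_)
  rw [neg_mul, neg_nonpos]
  positivity

theorem integral_heat {s : ℝ} (hs : 0 < s) :
    ∫ x : EuclideanSpace ℝ (Fin n), heat s x = 1 := by
  have hb : 0 < 1 / (4 * s) := by positivity
  have hp : 0 < 4 * Real.pi * s := by have := Real.pi_pos; positivity
  unfold heat
  rw [integral_const_mul, GaussianFourier.integral_rexp_neg_mul_sq_norm hb,
    finrank_euclideanSpace_fin]
  have : Real.pi / (1 / (4 * s)) = 4 * Real.pi * s := by field_simp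
  rw [this]
  exact inv_mul_cancel₀ (Real.rpow_pos_of_pos hp _).ne'

theorem integrable_heat {s : ℝ} (hs : 0 < s) :
    Integrable fun x : EuclideanSpace ℝ (Fin n) => heat s x :=
  Integrable.of_integral_ne_zero (by rw [integral_heat hs]; exact one_ne_zero)

/-- Completing the square in `y`: the product is a Gaussian centred at `(s / (s + r)) x`, so
integrating over `y` leaves `heat (s + r) x`. -/
theorem heat_mul_heat {s r : ℝ} (hs : 0 < s) (hr : 0 < r) (x y : EuclideanSpace ℝ (Fin n)) :
    heat s y * heat r (x - y) =
      heat (s + r) x * heat (s * r / (s + r)) (y - (s / (s + r)) • x) := by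
  have hp := Real.pi_pos
  have hsr : 0 < s + r := by positivity
  unfold heat
  rw [mul_mul_mul_comm, mul_mul_mul_comm (_ ⁻¹) _ (_ ⁻¹), ← Real.exp_add, ← Real.exp_add,
    ← mul_inv, ← mul_inv, ← Real.mul_rpow (by positivity) (by positivity),
    ← Real.mul_rpow (by positivity) (by positivity)]
  congr 1
  · congr 2
    field_simp
  · congr 1
    rw [norm_sub_sq_real, norm_sub_sq_real, norm_smul, inner_smul_right, Real.norm_of_nonneg
      (by positivity), real_inner_comm x y]
    field_simp
    ring

theorem integrable_heat_mul_heat {s r : ℝ} (hs : 0 < s) (hr : 0 < r)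
    (x : EuclideanSpace ℝ (Fin n)) : Integrable fun y => heat s y * heat r (x - y) := by
  simp_rw [heat_mul_heat hs hr]
  exact ((integrable_heat (by positivity)).comp_sub_right _).const_mul _

theorem integral_heat_mul_heat {s r : ℝ} (hs : 0 < s) (hr : 0 < r)
    (x : EuclideanSpace ℝ (Fin n)) : ∫ y, heat s y * heat r (x - y) = heat (s + r) x := by
  simp_rw [heat_mul_heat hs hr]
  rw [integral_const_mul, integral_sub_right_eq_self (fun y => heat (s * r / (s + r)) y),
    integral_heat (by positivity), mul_one]

/-! ### Kernels subordinated to functions of time. -/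

/-- The space-time kernel `a(s) · heat s x` subordinated to a function `a` on `(0,∞)`. -/
noncomputable def subKernel (n : ℕ) (a : ℝ → ℝ) (z : SpaceTime n) : ℝ := a z.2 * heat z.2 z.1

theorem Phi_eq_subKernel (α : ℝ) (z : SpaceTime n) :
    Phi n α z.1 z.2 = subKernel n (rlKernel α) z := by
  unfold Phi subKernel rlKernel heat
  split_ifs
  · rw [one_div, mul_assoc]
    congr 3
    ring
  · rw [zero_mul]

theorem measurable_subKernel {a : ℝ → ℝ} (ha : Measurable a) : Measurable (subKernel n a) :=
  (ha.comp measurable_snd).mul measurable_heat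

theorem norm_subKernel {a : ℝ → ℝ} (ha0 : ∀ s ≤ 0, a s = 0) (z : SpaceTime n) :
    ‖subKernel n a z‖ = ‖a z.2‖ * heat z.2 z.1 := by
  rcases le_or_gt z.2 0 with h | h
  · simp [subKernel, ha0 _ h]
  · rw [subKernel, norm_mul, Real.norm_of_nonneg (heat_nonneg h.le _)]

theorem lintegral_enorm_subKernel {a : ℝ → ℝ} (ha : Measurable a) (ha0 : ∀ s ≤ 0, a s = 0) :
    ∫⁻ z, ‖subKernel n a z‖ₑ = ∫⁻ s, ‖a s‖ₑ := by
  rw [Measure.volume_eq_prod, lintegral_prod_symm _ (measurable_subKernel ha).enorm.aemeasurable]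
  refine lintegral_congr fun s => ?_
  rcases le_or_gt s 0 with h | h
  · simp [subKernel, ha0 _ h]
  · simp only [subKernel, enorm_mul]
    rw [lintegral_const_mul' _ _ (by simp)]
    have h1 : ∫⁻ x : EuclideanSpace ℝ (Fin n), ‖heat s x‖ₑ = 1 := by
      rw [← ofReal_integral_norm_eq_lintegral_enorm (integrable_heat h)]
      simp_rw [Real.norm_of_nonneg (heat_nonneg h.le _)]
      rw [integral_heat h, ENNReal.ofReal_one]
    rw [h1, mul_one]

theorem integrable_subKernel {a : ℝ → ℝ} (ha : Measurable a) (ha0 : ∀ s ≤ 0, a s = 0)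
    (hai : Integrable a) : Integrable (subKernel n a) :=
  ⟨(measurable_subKernel ha).aestronglyMeasurable, by
    rw [hasFiniteIntegral_iff_enorm, lintegral_enorm_subKernel ha ha0]
    exact hai.2⟩

theorem integral_subKernel_mul_slice {a b : ℝ → ℝ} (ha0 : ∀ s ≤ 0, a s = 0)
    (hb0 : ∀ s ≤ 0, b s = 0) (z : SpaceTime n) (r : ℝ) :
    Integrable (fun y => subKernel n a (y, r) * subKernel n b (z - (y, r))) ∧
    ∫ y, subKernel n a (y, r) * subKernel n b (z - (y, r)) =
      a r * b (z.2 - r) * heat z.2 z.1 := by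
  simp only [subKernel, Prod.fst_sub, Prod.snd_sub]
  rcases le_or_gt r 0 with h | h
  · simp [ha0 _ h]
  rcases le_or_gt (z.2 - r) 0 with h' | h'
  · simp [hb0 _ h']
  have e (y : EuclideanSpace ℝ (Fin n)) : a r * heat r y * (b (z.2 - r) * heat (z.2 - r) (z.1 - y)) =
    a r * b (z.2 - r) * (heat r y * heat (z.2 - r) (z.1 - y)) := by ring
  simp_rw [e]
  refine ⟨(integrable_heat_mul_heat h h' _).const_mul _, ?_⟩
  rw [integral_const_mul, integral_heat_mul_heat h h', add_sub_cancel]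

/-- Tonelli, space first: on each time slice the semigroup law collapses the space integral, leaving
the one-dimensional convolution integrand times a constant. -/
theorem convolutionExistsAt_subKernel {a b : ℝ → ℝ} (ha : Measurable a) (hb : Measurable b)
    (ha0 : ∀ s ≤ 0, a s = 0) (hb0 : ∀ s ≤ 0, b s = 0) {z : SpaceTime n}
    (h : ConvolutionExistsAt a b z.2 (mul ℝ ℝ) volume) :
    ConvolutionExistsAt (subKernel n a) (subKernel n b) z (mul ℝ ℝ) volume := by
  have hm : Measurable fun w => subKernel n a w * subKernel n b (z - w) :=
    (measurable_subKernel ha).mul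
      ((measurable_subKernel hb).comp (measurable_const.sub measurable_id))
  rw [ConvolutionExistsAt, Measure.volume_eq_prod]
  refine (integrable_prod_iff' hm.aestronglyMeasurable).2
    ⟨Eventually.of_forall fun r => (integral_subKernel_mul_slice ha0 hb0 z r).1, ?_⟩
  refine (h.norm.mul_const (heat z.2 z.1)).congr (Eventually.of_forall fun r => ?_)
  have h1 := (integral_subKernel_mul_slice (n := n) (a := fun s => ‖a s‖) (b := fun s => ‖b s‖)
    (fun s hs => by simp [ha0 s hs]) (fun s hs => by simp [hb0 s hs]) z r).2
  simp only [mul_apply', norm_mul]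
  rw [← h1]
  congr 1
  ext y
  rw [norm_subKernel ha0, norm_subKernel hb0]
  rfl

theorem convolution_subKernel {a b : ℝ → ℝ} (ha : Measurable a) (hb : Measurable b)
    (ha0 : ∀ s ≤ 0, a s = 0) (hb0 : ∀ s ≤ 0, b s = 0) {z : SpaceTime n}
    (h : ConvolutionExistsAt a b z.2 (mul ℝ ℝ) volume) :
    (subKernel n a ⋆[mul ℝ ℝ, volume] subKernel n b) z =
      subKernel n (a ⋆[mul ℝ ℝ, volume] b) z := by
  have hi := convolutionExistsAt_subKernel ha hb ha0 hb0 h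
  simp only [ConvolutionExistsAt, mul_apply'] at hi
  rw [Measure.volume_eq_prod] at hi
  rw [convolution_mul, Measure.volume_eq_prod, integral_prod_symm _ hi]
  simp_rw [(integral_subKernel_mul_slice ha0 hb0 z _).2]
  rw [integral_mul_const, subKernel, convolution_mul]

/-! ### Absolute convergence of the potential. -/

theorem enorm_le_one_add_rpow {p : ℝ} (hp : 1 ≤ p) (a : ℝ≥0∞) : a ≤ 1 + a ^ p := by
  rcases le_total a 1 with h | h
  · exact h.trans le_self_add
  · refine le_trans ?_ le_add_self
    simpa using ENNReal.rpow_le_rpow_of_exponent_le h hp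

theorem lintegral_lintegral_mul_sub {A B : SpaceTime n → ℝ≥0∞} (hA : Measurable A)
    (hB : Measurable B) :
    ∫⁻ z, ∫⁻ t, A t * B (z - t) = (∫⁻ t, A t) * ∫⁻ w, B w := by
  rw [lintegral_lintegral_swap (by fun_prop)]
  have h (t : SpaceTime n) : ∫⁻ z, A t * B (z - t) = A t * ∫⁻ w, B w := by
    rw [lintegral_const_mul _ (by fun_prop), lintegral_sub_right_eq_self]
  simp_rw [h]
  rw [lintegral_mul_const _ hA]

theorem subKernel_rlKernel_tail_le {α s : ℝ} (hα : 0 < α) (hα' : α ≤ ((n : ℝ) + 2) / 2)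
    (hs : 1 < s) (x : EuclideanSpace ℝ (Fin n)) :
    subKernel n (rlKernel α) (x, s) ≤
      (Real.Gamma α)⁻¹ * ((4 * Real.pi) ^ ((n : ℝ) / 2))⁻¹ := by
  have hp := Real.pi_pos
  have hs0 : 0 < s := by linarith
  have hG := Real.Gamma_pos_of_pos hα
  calc subKernel n (rlKernel α) (x, s)
      ≤ rlKernel α s * ((4 * Real.pi * s) ^ ((n : ℝ) / 2))⁻¹ :=
        mul_le_mul_of_nonneg_left (heat_le hs0.le x) (rlKernel_nonneg hα s)
    _ = (Real.Gamma α)⁻¹ * ((4 * Real.pi) ^ ((n : ℝ) / 2))⁻¹ * s ^ (α - 1 - (n : ℝ) / 2) := by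
        rw [rlKernel_of_pos hs0, Real.mul_rpow (by positivity) hs0.le, Real.rpow_sub hs0 (α - 1)]
        field_simp
    _ ≤ _ := by
        refine mul_le_of_le_one_right (by positivity) ?_
        exact Real.rpow_le_one_of_one_le_of_nonpos hs.le (by linarith)

/-- Only `q - 1` of the `q` powers of `heat` are replaced by the supremum; the remaining one
integrates to `1` in space. -/
theorem subKernel_rlKernel_rpow_le {α s q : ℝ} (hα : 0 < α) (hq : 1 < q)
    (hs : 0 < s) (x : EuclideanSpace ℝ (Fin n)) :
    subKernel n (rlKernel α) (x, s) ^ q ≤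
      ((Real.Gamma α)⁻¹ ^ q * ((4 * Real.pi) ^ ((n : ℝ) / 2 * (q - 1)))⁻¹ *
        s ^ ((α - 1) * q - (n : ℝ) / 2 * (q - 1))) * heat s x := by
  have hp := Real.pi_pos
  have hG := Real.Gamma_pos_of_pos hα
  have hh := heat_pos hs x
  have h1 : heat s x ^ q = heat s x ^ (q - 1) * heat s x := by
    rw [← Real.rpow_add_one hh.ne', sub_add_cancel]
  rw [subKernel, Real.mul_rpow (rlKernel_nonneg hα s) hh.le, h1, ← mul_assoc]
  refine mul_le_mul_of_nonneg_right ?_ hh.le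
  calc rlKernel α s ^ q * heat s x ^ (q - 1)
      ≤ rlKernel α s ^ q * (((4 * Real.pi * s) ^ ((n : ℝ) / 2))⁻¹) ^ (q - 1) :=
        mul_le_mul_of_nonneg_left (Real.rpow_le_rpow hh.le (heat_le hs.le x) (by linarith))
          (Real.rpow_nonneg (rlKernel_nonneg hα s) _)
    _ = _ := by
        rw [rlKernel_of_pos hs, div_eq_mul_inv, Real.mul_rpow (by positivity) (by positivity),
          ← Real.rpow_mul hs.le, Real.inv_rpow (by positivity), Real.inv_rpow (by positivity),
          ← Real.rpow_mul (by positivity),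
          Real.mul_rpow (by positivity) hs.le, Real.rpow_sub hs]
        field_simp

theorem lintegral_tail_rpow_lt_top {α q : ℝ} (hα : 0 < α) (hq : 1 < q)
    (hαq : (α - 1) * q - (n : ℝ) / 2 * (q - 1) < -1) :
    ∫⁻ z, ‖subKernel n ((Ioi 1).indicator (rlKernel α)) z‖ₑ ^ q < ∞ := by
  set c := (Real.Gamma α)⁻¹ ^ q * ((4 * Real.pi) ^ ((n : ℝ) / 2 * (q - 1)))⁻¹
  set e := (α - 1) * q - (n : ℝ) / 2 * (q - 1)
  set a : ℝ → ℝ := (Ioi 1).indicator fun s => c * s ^ e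
  have ha : Measurable a := Measurable.indicator (by fun_prop) measurableSet_Ioi
  have ha0 : ∀ s ≤ 0, a s = 0 := fun s hs => indicator_of_notMem (by simp; linarith) _
  have hai : Integrable a :=
    (integrable_indicator_iff measurableSet_Ioi).2
      ((integrableOn_Ioi_rpow_of_lt hαq one_pos).const_mul c)
  refine lt_of_le_of_lt (lintegral_mono fun z => ?_) (integrable_subKernel (n := n) ha ha0 hai).2
  by_cases hz : z.2 ∈ Ioi (1 : ℝ)
  · have h1 : subKernel n ((Ioi 1).indicator (rlKernel α)) z = subKernel n (rlKernel α) z := by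
      simp [subKernel, indicator_of_mem hz]
    have h0 : (0 : ℝ) < z.2 := one_pos.trans hz
    have h2 : 0 ≤ subKernel n (rlKernel α) z :=
      mul_nonneg (rlKernel_nonneg hα _) (heat_nonneg h0.le _)
    rw [h1, ← Real.enorm_rpow_of_nonneg h2 (by linarith)]
    refine enorm_le_iff_norm_le.2 ?_
    have h3 : subKernel n a z = c * z.2 ^ e * heat z.2 z.1 := by
      simp only [subKernel, a, indicator_of_mem hz]
    rw [Real.norm_of_nonneg (by positivity), h3]
    exact (subKernel_rlKernel_rpow_le hα hq h0 z.1).trans (le_abs_self _)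
  · simp [subKernel, indicator_of_notMem hz, ENNReal.zero_rpow_of_pos (by linarith : 0 < q)]

/-- The range of exponents for which `J_α` is defined on `L^p`. -/
def Admissible (n : ℕ) (p α : ℝ) : Prop :=
  (1 < p ∧ 0 < α ∧ α < ((n : ℝ) + 2) / (2 * p)) ∨ (p = 1 ∧ 0 < α ∧ α ≤ ((n : ℝ) + 2) / (2 * p))

theorem Admissible.one_le {p α : ℝ} (h : Admissible n p α) : 1 ≤ p := by
  rcases h with h | h
  · exact h.1.le
  · exact h.1.ge

theorem Admissible.pos {p α : ℝ} (h : Admissible n p α) : 0 < α := by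
  rcases h with h | h <;> exact h.2.1

/-- For `p > 1` the tail lies in `L^q` with `q` conjugate to `p`, and Young's inequality under the
integral suffices. For `p = 1` the tail is bounded, which allows the endpoint `α = (n + 2) / 2`. -/
theorem exists_lintegral_tail_le {p α : ℝ} (h : Admissible n p α) {f : SpaceTime n → ℝ}
    (hf : Measurable f) (hfp : ∫⁻ w, ‖f w‖ₑ ^ p < ∞) :
    ∃ C : ℝ≥0∞, C < ∞ ∧ ∀ z, ∫⁻ t, ‖subKernel n ((Ioi 1).indicator (rlKernel α)) t‖ₑ *
      ‖f (z - t)‖ₑ ≤ C := by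
  have hsub (z : SpaceTime n) (p : ℝ) : ∫⁻ t, ‖f (z - t)‖ₑ ^ p = ∫⁻ w, ‖f w‖ₑ ^ p :=
    lintegral_sub_left_eq_self (fun w => ‖f w‖ₑ ^ p) z
  rcases h with ⟨hp, hα, hα'⟩ | ⟨rfl, hα, hα'⟩
  · have hpq : p.HolderConjugate (p / (p - 1)) := Real.HolderConjugate.conjExponent hp
    set q := p / (p - 1)
    have hT := lintegral_tail_rpow_lt_top (n := n) (α := α) hα hpq.symm.lt (by
      have hp1 : 0 < p - 1 := by linarith
      rw [lt_div_iff₀ (by linarith)] at hα'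
      -- This quotient is below `-1` exactly when `α p < n / 2 + 1`, the strict form of
      -- admissibility.
      have e : (α - 1) * q - (n : ℝ) / 2 * (q - 1) = ((α - 1) * p - n / 2) / (p - 1) := by
        simp only [q]
        field_simp
        ring
      rw [e, div_lt_iff₀ hp1]
      linarith)
    refine ⟨(∫⁻ z, ‖subKernel n ((Ioi 1).indicator (rlKernel α)) z‖ₑ ^ q) / ENNReal.ofReal q +
      (∫⁻ w, ‖f w‖ₑ ^ p) / ENNReal.ofReal p, ENNReal.add_lt_top.2
        ⟨ENNReal.div_lt_top hT.ne (by simpa using hpq.symm.pos),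
          ENNReal.div_lt_top hfp.ne (by simpa using hpq.pos)⟩, fun z => ?_⟩
    refine (lintegral_mono fun t => ENNReal.young_inequality _ _ hpq.symm).trans (le_of_eq ?_)
    have hm : Measurable (subKernel n ((Ioi 1).indicator (rlKernel α))) :=
      measurable_subKernel ((measurable_rlKernel α).indicator measurableSet_Ioi)
    simp only [div_eq_mul_inv]
    rw [lintegral_add_left (by fun_prop), lintegral_mul_const _ (by fun_prop),
      lintegral_mul_const _ (by fun_prop), hsub]
  · set c := (Real.Gamma α)⁻¹ * ((4 * Real.pi) ^ ((n : ℝ) / 2))⁻¹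
    refine ⟨‖c‖ₑ * ∫⁻ w, ‖f w‖ₑ ^ (1 : ℝ), ENNReal.mul_lt_top (by simp) hfp, fun z => ?_⟩
    rw [← hsub z, ← lintegral_const_mul _ (by fun_prop)]
    refine lintegral_mono fun t => ?_
    simp only [ENNReal.rpow_one]
    refine mul_le_mul_left (enorm_le_iff_norm_le.2 ?_) _
    by_cases ht : t.2 ∈ Ioi (1 : ℝ)
    · have h1 : subKernel n ((Ioi 1).indicator (rlKernel α)) t = subKernel n (rlKernel α) t := by
        simp only [subKernel, indicator_of_mem ht]
      have h2 : 0 ≤ subKernel n (rlKernel α) t :=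
        mul_nonneg (rlKernel_nonneg hα _) (heat_nonneg (zero_le_one.trans (le_of_lt ht)) _)
      rw [h1, Real.norm_of_nonneg h2]
      exact (subKernel_rlKernel_tail_le hα (by simpa using hα') ht t.1).trans (le_abs_self _)
    · simp [subKernel, indicator_of_notMem ht]

/-- `W` is the kernel for `s ≤ 1` convolved with `|f|^p`, hence integrable; `|f| ≤ 1 + |f|^p` puts
the rest into `C`. The form `C + W` stays finite almost everywhere after convolution with a further
integrable kernel. -/
theorem exists_lintegral_subKernel_mul_le {p α : ℝ} (h : Admissible n p α) {f : SpaceTime n → ℝ}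
    (hf : Measurable f) (hfp : ∫⁻ w, ‖f w‖ₑ ^ p < ∞) :
    ∃ (C : ℝ≥0∞) (W : SpaceTime n → ℝ≥0∞), C < ∞ ∧ Measurable W ∧ ∫⁻ z, W z < ∞ ∧
      ∀ z, ∫⁻ t, ‖subKernel n (rlKernel α) t‖ₑ * ‖f (z - t)‖ₑ ≤ C + W z := by
  obtain ⟨C, hC, hCle⟩ := exists_lintegral_tail_le h hf hfp
  set a := (Iic 1).indicator (rlKernel α)
  have ha : Measurable a := (measurable_rlKernel α).indicator measurableSet_Iic
  have ha0 : ∀ s ≤ 0, a s = 0 := fun s hs => by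
    simp only [a, indicator_apply, rlKernel_of_nonpos hs, ite_self]
  have hai : Integrable a :=
    (integrable_indicator_iff measurableSet_Iic).2 (integrableOn_rlKernel h.pos 1)
  have hK := integrable_subKernel (n := n) ha ha0 hai
  have hKm := measurable_subKernel (n := n) ha
  have hKm' := measurable_subKernel (n := n) ((measurable_rlKernel α).indicator
    (measurableSet_Ioi (a := 1)))
  refine ⟨C + ∫⁻ t, ‖subKernel n a t‖ₑ, fun z => ∫⁻ t, ‖subKernel n a t‖ₑ * ‖f (z - t)‖ₑ ^ p,
    ENNReal.add_lt_top.2 ⟨hC, hK.2⟩, ?_, ?_, fun z => ?_⟩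
  · exact Measurable.lintegral_prod_right' (f := fun q : SpaceTime n × SpaceTime n =>
      ‖subKernel n a q.2‖ₑ * ‖f (q.1 - q.2)‖ₑ ^ p) (by fun_prop)
  · rw [lintegral_lintegral_mul_sub (A := fun t => ‖subKernel n a t‖ₑ)
      (B := fun t => ‖f t‖ₑ ^ p) (by fun_prop) (by fun_prop)]
    exact ENNReal.mul_lt_top hK.2 hfp
  · rw [add_assoc]
    refine le_trans ?_ (add_le_add_left (hCle z) _)
    rw [← lintegral_add_left (by fun_prop), ← lintegral_add_left (by fun_prop)]
    refine lintegral_mono fun t => ?_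
    dsimp only
    by_cases ht : t.2 ∈ Ioi (1 : ℝ)
    · refine le_trans (le_of_eq ?_) le_self_add
      rw [subKernel, subKernel, indicator_of_mem ht]
    · refine le_trans ?_ le_add_self
      have : subKernel n (rlKernel α) t = subKernel n a t := by
        have ht' : t.2 ∈ Iic (1 : ℝ) := by simpa using ht
        simp only [subKernel, a, indicator_of_mem ht']
      rw [this]
      nth_rw 2 [← mul_one ‖subKernel n a t‖ₑ]
      rw [← mul_add]
      exact mul_le_mul_right (enorm_le_one_add_rpow h.one_le _) _

theorem ae_integrable_subKernel_mul {p α : ℝ} (h : Admissible n p α) {f : SpaceTime n → ℝ}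
    (hf : Measurable f) (hfp : ∫⁻ w, ‖f w‖ₑ ^ p < ∞) :
    ∀ᵐ z, Integrable fun t => subKernel n (rlKernel α) t * f (z - t) := by
  obtain ⟨C, W, hC, hW, hWi, hle⟩ := exists_lintegral_subKernel_mul_le h hf hfp
  have hK := measurable_subKernel (n := n) (measurable_rlKernel α)
  filter_upwards [ae_lt_top hW hWi.ne] with z hz
  refine ⟨by fun_prop, ?_⟩
  simp_rw [hasFiniteIntegral_iff_enorm, enorm_mul]
  exact (hle z).trans_lt (ENNReal.add_lt_top.2 ⟨hC, hz⟩)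

/-! ### Associativity and causality. -/

theorem ae_convolution_subKernel_assoc {p α : ℝ} (h : Admissible n p α) {f : SpaceTime n → ℝ}
    (hf : Measurable f) (hfp : ∫⁻ w, ‖f w‖ₑ ^ p < ∞) {a : ℝ → ℝ} (ha : Continuous a)
    (hai : Integrable a) (ha0 : ∀ s ≤ 0, a s = 0) :
    ∀ᵐ z, (subKernel n (rlKernel α ⋆[mul ℝ ℝ, volume] a) ⋆[mul ℝ ℝ, volume] f) z =
      (subKernel n a ⋆[mul ℝ ℝ, volume] (subKernel n (rlKernel α) ⋆[mul ℝ ℝ, volume] f)) z := by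
  obtain ⟨C, W, hC, hW, hWi, hle⟩ := exists_lintegral_subKernel_mul_le h hf hfp
  have hK := measurable_subKernel (n := n) (measurable_rlKernel α)
  have hA := measurable_subKernel (n := n) ha.measurable
  have hAi := integrable_subKernel (n := n) ha.measurable ha0 hai
  have hκ0 : ∀ s ≤ 0, rlKernel α s = 0 := fun s hs => rlKernel_of_nonpos hs
  have hex : ConvolutionExists a (rlKernel α) (mul ℝ ℝ) volume := fun s =>
    ConvolutionExistsAt.integrable_swap (L := mul ℝ ℝ) (integrable_rlKernel_mul h.pos ha ha0 s)
      |>.congr (Eventually.of_forall fun t => by simp [mul_comm])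
  have hcomm : subKernel n (rlKernel α ⋆[mul ℝ ℝ, volume] a) =
      subKernel n a ⋆[mul ℝ ℝ, volume] subKernel n (rlKernel α) := by
    ext z
    rw [convolution_subKernel ha.measurable (measurable_rlKernel α) ha0 hκ0 (hex _)]
    simp only [subKernel]
    rw [convolution_mul, convolution_mul_swap]
    simp_rw [mul_comm]
  rw [hcomm]
  have hWA : ∫⁻ z, ∫⁻ t, ‖subKernel n a t‖ₑ * W (z - t) < ∞ := by
    rw [lintegral_lintegral_mul_sub hA.enorm hW]
    exact ENNReal.mul_lt_top hAi.2 hWi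
  have hWAm : Measurable fun z => ∫⁻ t, ‖subKernel n a t‖ₑ * W (z - t) :=
    Measurable.lintegral_prod_right' (f := fun q : SpaceTime n × SpaceTime n =>
      ‖subKernel n a q.2‖ₑ * W (q.1 - q.2)) (by fun_prop)
  filter_upwards [ae_lt_top hWAm hWA.ne] with z hz
  refine convolution_assoc (mul ℝ ℝ) (mul ℝ ℝ) (mul ℝ ℝ) (mul ℝ ℝ) (fun x y z => mul_assoc x y z)
    hA.aestronglyMeasurable hK.aestronglyMeasurable hf.aestronglyMeasurable
    (Eventually.of_forall fun y =>
      convolutionExistsAt_subKernel ha.measurable (measurable_rlKernel α) ha0 hκ0 (hex _)) ?_ ?_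
  · filter_upwards [ae_integrable_subKernel_mul h hf hfp] with x hx
    exact hx.norm.congr (Eventually.of_forall fun t => by simp)
  · have hm : StronglyMeasurable fun z => ∫ t, ‖subKernel n (rlKernel α) t‖ * ‖f (z - t)‖ :=
      StronglyMeasurable.integral_prod_right' (ν := volume)
        (f := fun q : SpaceTime n × SpaceTime n =>
          ‖subKernel n (rlKernel α) q.2‖ * ‖f (q.1 - q.2)‖)
        (Measurable.stronglyMeasurable (by fun_prop))
    simp only [ConvolutionExistsAt, mul_apply', convolution_def]
    refine ⟨(hA.norm.mul
      (hm.measurable.comp (measurable_const.sub measurable_id))).aestronglyMeasurable, ?_⟩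
    rw [hasFiniteIntegral_iff_enorm]
    have hbound : ∫⁻ t, ‖subKernel n a t‖ₑ * (C + W (z - t)) < ∞ := by
      simp_rw [mul_add]
      rw [lintegral_add_left (by fun_prop), lintegral_mul_const _ (by fun_prop)]
      exact ENNReal.add_lt_top.2 ⟨ENNReal.mul_lt_top hAi.2 hC, hz⟩
    refine lt_of_le_of_lt (lintegral_mono fun t => ?_) hbound
    rw [enorm_mul, enorm_norm]
    refine mul_le_mul_right (le_trans (enorm_integral_le_lintegral_enorm _) ?_) _
    simpa only [enorm_mul, enorm_norm] using hle (z - t)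

theorem measurableSet_slab (n : ℕ) (T : ℝ) : MeasurableSet (slab n T) :=
  MeasurableSet.univ.prod measurableSet_Iio

theorem isOpen_slab (n : ℕ) (T : ℝ) : IsOpen (slab n T) := isOpen_univ.prod isOpen_Iio

theorem locallyIntegrable_of_lintegral_rpow {p : ℝ} (hp : 1 ≤ p) {f : SpaceTime n → ℝ}
    (hf : Measurable f) (hfp : ∫⁻ w, ‖f w‖ₑ ^ p < ∞) : LocallyIntegrable f := by
  rw [locallyIntegrable_iff]
  intro k hk
  refine ⟨hf.aestronglyMeasurable, ?_⟩
  rw [hasFiniteIntegral_iff_enorm]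
  refine lt_of_le_of_lt (lintegral_mono fun w => enorm_le_one_add_rpow hp _) ?_
  rw [lintegral_add_left measurable_const]
  refine ENNReal.add_lt_top.2 ⟨?_, (setLIntegral_le_lintegral _ _).trans_lt hfp⟩
  simpa using hk.measure_lt_top

/-- The fractional derivative of `g` vanishes at nonpositive times, so at `z` in the slab only
values of `K_α ⋆ f` at earlier times enter, and these are zero. -/
theorem ae_convolution_subKernel_eq_zero {p α T : ℝ} (h : Admissible n p α) {f : SpaceTime n → ℝ}
    (hf : Measurable f) (hfp : ∫⁻ w, ‖f w‖ₑ ^ p < ∞)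
    (h0 : ∀ᵐ z, z ∈ slab n T → (subKernel n (rlKernel α) ⋆[mul ℝ ℝ, volume] f) z = 0)
    {g : ℝ → ℝ} (hg : ContDiff ℝ (⊤ : ℕ∞) g) (hgc : HasCompactSupport g)
    (hg0 : tsupport g ⊆ Ioi 0) :
    ∀ᵐ z, z ∈ slab n T → (subKernel n g ⋆[mul ℝ ℝ, volume] f) z = 0 := by
  have hα := h.pos
  -- Order `m + 1` with `b = m + 1 - α` gives `b > 0` even for integer `α`, and `α > 0` gives the
  -- bound `b < m + 1` needed for integrability.
  set m := ⌊α⌋₊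
  have hm : α < m + 1 := Nat.lt_floor_add_one α
  have hb : 0 < (m : ℝ) + 1 - α := by linarith
  have hg' := rlKernel_convolution_rlDeriv hg hgc hg0 (m := m) hα hb (by ring)
  have hassoc := ae_convolution_subKernel_assoc h hf hfp
    (continuous_rlDeriv hg hgc (m + 1) hb)
    (integrable_rlDeriv hg hgc hg0 hb (by push_cast; linarith))
    (fun s hs => rlDeriv_eq_zero_of_nonpos hg0 _ _ hs)
  rw [hg'] at hassoc
  filter_upwards [hassoc] with z hz hzT
  rw [hz, convolution_mul]
  refine integral_eq_zero_of_ae ?_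
  filter_upwards [(quasiMeasurePreserving_sub_left_of_right_invariant volume z).ae h0] with t ht
  rcases le_or_gt t.2 0 with h2 | h2
  · simp [subKernel, rlDeriv_eq_zero_of_nonpos hg0 _ _ h2]
  · have hmem : z - t ∈ slab n T := by
      refine ⟨mem_univ _, ?_⟩
      have := hzT.2
      simp only [mem_Iio, Prod.snd_sub] at this ⊢
      linarith
    simp [ht hmem]

/-! ### Recovering a value at the origin as time tends to zero. -/

theorem heat_sqrt_smul {s : ℝ} (hs : 0 < s) (y : EuclideanSpace ℝ (Fin n)) :
    heat s (√s • y) = (√s ^ n)⁻¹ * heat 1 y := by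
  have hp := Real.pi_pos
  have hsq : √s ^ n = s ^ ((n : ℝ) / 2) := by
    rw [Real.sqrt_eq_rpow, ← Real.rpow_natCast, ← Real.rpow_mul hs.le]
    congr 1
    ring
  unfold heat
  rw [Real.mul_rpow (by positivity) hs.le, norm_smul, Real.norm_of_nonneg (Real.sqrt_nonneg s),
    mul_pow, Real.sq_sqrt hs.le, hsq, mul_one, mul_inv, mul_one]
  have : -(1 / (4 * s)) * (s * ‖y‖ ^ 2) = -(1 / 4) * ‖y‖ ^ 2 := by
    field_simp
  rw [this]
  ring

theorem integral_heat_mul {s : ℝ} (hs : 0 < s) (F : EuclideanSpace ℝ (Fin n) → ℝ) :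
    ∫ x, heat s x * F x = ∫ y, heat 1 y * F (√s • y) := by
  have hq : 0 < √s := Real.sqrt_pos.2 hs
  have h := Measure.integral_comp_smul (volume : Measure (EuclideanSpace ℝ (Fin n)))
    (fun x => heat s x * F x) (√s)
  simp only [heat_sqrt_smul hs, finrank_euclideanSpace_fin, mul_assoc, smul_eq_mul] at h
  rw [integral_const_mul, abs_of_nonneg (by positivity)] at h
  exact (mul_left_cancel₀ (by positivity) h).symm

/-- A bounded continuous function on space-time annihilated by all kernels subordinated to test
functions on `(0,∞)` vanishes at the origin. -/
theorem eq_zero_of_integral_subKernel_mul {H : SpaceTime n → ℝ} (hH : Continuous H) {M : ℝ}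
    (hM : ∀ z, |H z| ≤ M)
    (h0 : ∀ g : ℝ → ℝ, ContDiff ℝ (⊤ : ℕ∞) g → HasCompactSupport g → tsupport g ⊆ Ioi 0 →
      ∫ z, subKernel n g z * H z = 0) : H 0 = 0 := by
  -- The substitution `x = √s y` fixes the Gaussian weight, so dominated convergence gives
  -- continuity through `s = 0`, where `Ψ 0 = H 0`. Since `√s = 0` for `s < 0`, `Ψ` is continuous on
  -- all of `ℝ`.
  set Ψ : ℝ → ℝ := fun s => ∫ y : EuclideanSpace ℝ (Fin n), heat 1 y * H (√s • y, s)
  have hheat : Continuous fun y : EuclideanSpace ℝ (Fin n) => heat 1 y := by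
    unfold heat
    fun_prop
  have hΨ : Continuous Ψ := by
    refine continuous_of_dominated (bound := fun y => heat 1 y * M)
      (fun s => Continuous.aestronglyMeasurable (by fun_prop))
      (fun s => Eventually.of_forall fun y => ?_) ((integrable_heat one_pos).mul_const M)
      (Eventually.of_forall fun y => by fun_prop)
    rw [norm_mul, Real.norm_of_nonneg (heat_nonneg zero_le_one y)]
    exact mul_le_mul_of_nonneg_left (hM _) (heat_nonneg zero_le_one y)
  have hΨ0 : ∀ᵐ s, s ∈ Ioi (0 : ℝ) → Ψ s = 0 := by
    refine isOpen_Ioi.ae_eq_zero_of_integral_contDiff_smul_eq_zero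
      (hΨ.locallyIntegrable.locallyIntegrableOn _) fun g hg hgc hg0 => ?_
    have hg00 : ∀ s ≤ 0, g s = 0 := fun s hs => iteratedDeriv_eq_zero_of_nonpos hg0 0 hs
    have hi : Integrable fun z => subKernel n g z * H z :=
      (integrable_subKernel hg.continuous.measurable hg00
        (hg.continuous.integrable_of_hasCompactSupport hgc)).mul_bdd (c := M)
        hH.aestronglyMeasurable (Eventually.of_forall hM)
    have h1 := h0 g hg hgc hg0
    rw [Measure.volume_eq_prod] at hi h1
    rw [integral_prod_symm _ hi] at h1
    rw [← h1]
    congr 1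
    ext s
    rcases le_or_gt s 0 with hs | hs
    · simp [subKernel, hg00 s hs]
    · simp only [subKernel, mul_assoc, smul_eq_mul, Ψ]
      rw [integral_const_mul, integral_heat_mul hs fun x => H (x, s)]
  have hΨz : Ψ 0 = 0 := by
    have h1 : EqOn Ψ 0 (Ioi 0) := Measure.eqOn_open_of_ae_eq (μ := volume)
      ((ae_restrict_iff' measurableSet_Ioi).2 hΨ0) isOpen_Ioi hΨ.continuousOn
      continuousOn_const
    have h2 := h1.closure hΨ continuous_const
    rw [closure_Ioi] at h2
    exact h2 self_mem_Ici
  have : Ψ 0 = H 0 := by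
    simp only [Ψ, Real.sqrt_zero, zero_smul]
    rw [integral_mul_const, integral_heat one_pos, one_mul]
    rfl
  rw [← this, hΨz]

/-! ### The uniqueness theorem. -/

theorem ae_eq_zero_of_convolution_eq_zero {p α T : ℝ} (h : Admissible n p α)
    {f : SpaceTime n → ℝ} (hf : Measurable f) (hfp : ∫⁻ w, ‖f w‖ₑ ^ p < ∞)
    (h0 : ∀ᵐ z, z ∈ slab n T → (subKernel n (rlKernel α) ⋆[mul ℝ ℝ, volume] f) z = 0) :
    ∀ᵐ z, z ∈ slab n T → f z = 0 := by
  refine (isOpen_slab n T).ae_eq_zero_of_integral_contDiff_smul_eq_zero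
    ((locallyIntegrable_of_lintegral_rpow h.one_le hf hfp).locallyIntegrableOn _)
    fun φ hφ hφc hφT => ?_
  have hφm : Measurable φ := hφ.continuous.measurable
  have hφi : Integrable φ := hφ.continuous.integrable_of_hasCompactSupport hφc
  obtain ⟨B, hB⟩ := hφ.continuous.bounded_above_of_compact_support hφc
  -- `H 0 = ∫ φ f` is the quantity to annihilate, and by Fubini `∫ subKernel g · H = ∫ φ ·
  -- (subKernel g ⋆ f)`.
  set H : SpaceTime n → ℝ := fun z => ∫ w, φ w * f (w - z)
  set M : ℝ≥0∞ := (∫⁻ w, ‖φ w‖ₑ) + ENNReal.ofReal B * ∫⁻ w, ‖f w‖ₑ ^ p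
  have hMtop : M < ∞ :=
    ENNReal.add_lt_top.2 ⟨hφi.2, ENNReal.mul_lt_top ENNReal.ofReal_lt_top hfp⟩
  have hM (z : SpaceTime n) : ∫⁻ w, ‖φ w‖ₑ * ‖f (w - z)‖ₑ ≤ M := by
    have h1 : ∫⁻ w, ‖f w‖ₑ ^ p = ∫⁻ w, ‖f (w - z)‖ₑ ^ p :=
      (lintegral_sub_right_eq_self (fun w => ‖f w‖ₑ ^ p) z).symm
    simp only [M]
    rw [h1, ← lintegral_const_mul _ (by fun_prop), ← lintegral_add_left (by fun_prop)]
    refine lintegral_mono fun w => ?_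
    dsimp only
    have h2 : ‖φ w‖ₑ ≤ ENNReal.ofReal B := by
      rw [← ofReal_norm]
      exact ENNReal.ofReal_le_ofReal (hB w)
    calc ‖φ w‖ₑ * ‖f (w - z)‖ₑ ≤ ‖φ w‖ₑ * (1 + ‖f (w - z)‖ₑ ^ p) :=
          mul_le_mul_right (enorm_le_one_add_rpow h.one_le _) _
      _ = ‖φ w‖ₑ + ‖φ w‖ₑ * ‖f (w - z)‖ₑ ^ p := by rw [mul_add, mul_one]
      _ ≤ _ := add_le_add_right (mul_le_mul_left h2 _) _
  have hHM (z : SpaceTime n) : |H z| ≤ M.toReal := by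
    rw [← Real.norm_eq_abs, ← toReal_enorm]
    refine ENNReal.toReal_mono hMtop.ne ((enorm_integral_le_lintegral_enorm _).trans ?_)
    simpa only [enorm_mul] using hM z
  have hHc : Continuous H := by
    have hl : LocallyIntegrable fun w => f (-w) :=
      locallyIntegrable_of_lintegral_rpow h.one_le (hf.comp measurable_neg)
        (by rwa [lintegral_neg_eq_self (fun w => ‖f w‖ₑ ^ p)])
    have := hφc.continuous_convolution_left (mul ℝ ℝ) hφ.continuous hl
    convert! this using 1
    ext z
    simp only [H, convolution_mul, neg_sub]
  have hH0 : H 0 = 0 := by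
    refine eq_zero_of_integral_subKernel_mul hHc hHM fun g hg hgc hg0 => ?_
    have hz := ae_convolution_subKernel_eq_zero h hf hfp h0 hg hgc hg0
    have hg00 : ∀ s ≤ 0, g s = 0 := fun s hs => iteratedDeriv_eq_zero_of_nonpos hg0 0 hs
    have hK := measurable_subKernel (n := n) hg.continuous.measurable
    have hKi := integrable_subKernel (n := n) hg.continuous.measurable hg00
      (hg.continuous.integrable_of_hasCompactSupport hgc)
    have hint : Integrable (Function.uncurry fun z w => subKernel n g z * (φ w * f (w - z)))
        (volume.prod volume) := by
      refine ⟨Measurable.aestronglyMeasurable (by fun_prop), ?_⟩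
      rw [hasFiniteIntegral_iff_enorm, lintegral_prod _ (by fun_prop)]
      simp only [Function.uncurry_apply_pair, enorm_mul]
      have h1 (z : SpaceTime n) : ∫⁻ w, ‖subKernel n g z‖ₑ * (‖φ w‖ₑ * ‖f (w - z)‖ₑ) ≤
          ‖subKernel n g z‖ₑ * M := by
        rw [lintegral_const_mul _ (by fun_prop)]
        exact mul_le_mul_right (hM z) _
      refine (lintegral_mono h1).trans_lt ?_
      rw [lintegral_mul_const _ (by fun_prop)]
      exact ENNReal.mul_lt_top hKi.2 hMtop
    have h2 : ∫ z, subKernel n g z * H z = ∫ z, ∫ w, subKernel n g z * (φ w * f (w - z)) := by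
      simp_rw [integral_const_mul]
      rfl
    rw [h2, integral_integral_swap hint]
    refine integral_eq_zero_of_ae ?_
    filter_upwards [hz] with w hw
    have h3 (z : SpaceTime n) : subKernel n g z * (φ w * f (w - z)) =
      φ w * (subKernel n g z * f (w - z)) := by ring
    simp_rw [h3]
    rw [integral_const_mul, ← convolution_mul]
    by_cases hwT : w ∈ tsupport φ
    · simp [hw (hφT hwT)]
    · simp [image_eq_zero_of_notMem_tsupport hwT]
  simpa [H] using hH0

/-! ### Truncation to slabs and the operator `J_α`. -/

theorem Phi_mul_eq_subKernel_mul_indicator {T : ℝ} (α : ℝ) (f : SpaceTime n → ℝ)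
    {z : SpaceTime n} (hz : z.2 ≤ T) (w : SpaceTime n) :
    Phi n α (z.1 - w.1) (z.2 - w.2) * f w =
      subKernel n (rlKernel α) (z - w) * (slab n T).indicator f w := by
  rw [← Phi_eq_subKernel, Prod.fst_sub, Prod.snd_sub]
  by_cases hw : w ∈ slab n T
  · rw [indicator_of_mem hw]
  · have h : ¬ 0 < z.2 - w.2 := fun h => hw ⟨mem_univ _, by simp only [mem_Iio]; linarith⟩
    simp [Phi, h]

theorem potential_eq_convolution {T : ℝ} (α : ℝ) (f : SpaceTime n → ℝ) {z : SpaceTime n}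
    (hz : z.2 ≤ T) : potential n α f z =
      (subKernel n (rlKernel α) ⋆[mul ℝ ℝ, volume] (slab n T).indicator f) z := by
  rw [potential_eq_integral, convolution_mul_swap]
  simp_rw [Phi_mul_eq_subKernel_mul_indicator α f hz]

theorem lintegral_indicator_rpow_lt_top {p : ℝ} (hp : 1 ≤ p) {f : SpaceTime n → ℝ} {T : ℝ}
    (hf : MemLp f (ENNReal.ofReal p) (volume.restrict (slab n T))) :
    ∫⁻ w, ‖(slab n T).indicator f w‖ₑ ^ p < ∞ := by
  have hp0 : 0 < p := by linarith
  have h := lintegral_rpow_enorm_lt_top_of_eLpNorm_lt_top (by simpa using hp0)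
    ENNReal.ofReal_ne_top hf.2
  rw [ENNReal.toReal_ofReal hp0.le, ← lintegral_indicator (measurableSet_slab n T)] at h
  refine lt_of_le_of_lt (lintegral_mono fun w => le_of_eq ?_) h
  by_cases hw : w ∈ slab n T
  · simp only [indicator_of_mem hw]
  · simp [indicator_of_notMem hw, ENNReal.zero_rpow_of_pos hp0]

/-- Each truncation to an integer time has its own exceptional null set; countably many cover every
`z`. -/
theorem ae_integrableOn_Phi_mul {p α : ℝ} (h : Admissible n p α) {f : SpaceTime n → ℝ}
    (hf : Measurable f)
    (hfp : ∀ T, MemLp f (ENNReal.ofReal p) (volume.restrict (slab n T))) :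
    ∀ᵐ z : SpaceTime n,
      IntegrableOn (fun w => Phi n α (z.1 - w.1) (z.2 - w.2) * f w) (slab n z.2) := by
  have h1 : ∀ᵐ z : SpaceTime n, ∀ N : ℕ, Integrable fun t =>
      subKernel n (rlKernel α) t * (slab n N).indicator f (z - t) :=
    ae_all_iff.2 fun N => ae_integrable_subKernel_mul h (hf.indicator (measurableSet_slab n N))
      (lintegral_indicator_rpow_lt_top h.one_le (hfp N))
  filter_upwards [h1] with z hz
  obtain ⟨N, hN⟩ := exists_nat_ge z.2
  have h2 := (hz N).comp_sub_left z
  simp only [sub_sub_cancel] at h2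
  refine Integrable.integrableOn ?_
  simpa only [Phi_mul_eq_subKernel_mul_indicator α f hN] using h2

/-- Uniqueness applied to the truncated difference. Since `potential` is `0` where the integral
diverges, subtraction is justified only where both integrals converge, hence almost everywhere. -/
theorem ae_eq_of_potential_ae_eq {p α T : ℝ} (h : Admissible n p α) {f₁ f₂ : SpaceTime n → ℝ}
    (hf₁ : Measurable f₁) (hf₂ : Measurable f₂)
    (hp₁ : MemLp f₁ (ENNReal.ofReal p) (volume.restrict (slab n T)))
    (hp₂ : MemLp f₂ (ENNReal.ofReal p) (volume.restrict (slab n T)))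
    (heq : ∀ᵐ z, z ∈ slab n T → potential n α f₁ z = potential n α f₂ z) :
    ∀ᵐ z, z ∈ slab n T → f₁ z = f₂ z := by
  have hms := measurableSet_slab n T
  have key := ae_eq_zero_of_convolution_eq_zero (T := T) h ((hf₁.sub hf₂).indicator hms)
    (lintegral_indicator_rpow_lt_top h.one_le (hp₁.sub hp₂)) ?_
  · filter_upwards [key] with z hz hzT
    have := hz hzT
    rw [indicator_of_mem hzT] at this
    exact sub_eq_zero.1 this
  · filter_upwards [heq,
      ae_integrable_subKernel_mul h (hf₁.indicator hms) (lintegral_indicator_rpow_lt_top h.one_le hp₁),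
      ae_integrable_subKernel_mul h (hf₂.indicator hms) (lintegral_indicator_rpow_lt_top h.one_le hp₂)]
      with z hz hi₁ hi₂ hzT
    have hzT' : z.2 ≤ T := le_of_lt hzT.2
    have h1 := hz hzT
    rw [potential_eq_convolution α f₁ hzT', potential_eq_convolution α f₂ hzT', convolution_mul,
      convolution_mul, ← sub_eq_zero, ← integral_sub hi₁ hi₂] at h1
    rw [convolution_mul, ← h1]
    congr 1
    ext t
    rw [indicator_sub', ← mul_sub]
    rfl

theorem potential_eq_zero_of_ae_eq_zero {T : ℝ} (α : ℝ) {f : SpaceTime n → ℝ}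
    (hf : ∀ᵐ z, z ∈ slab n T → f z = 0) {z : SpaceTime n} (hz : z.2 ≤ T) :
    potential n α f z = 0 := by
  rw [potential_eq_convolution α f hz, convolution_mul_swap]
  refine integral_eq_zero_of_ae ?_
  filter_upwards [hf] with w hw
  by_cases hwT : w ∈ slab n T
  · simp [indicator_of_mem hwT, hw hwT]
  · simp [indicator_of_notMem hwT]

theorem J_coeFn (p α : ℝ) (f : X n p) :
    J n p α f =ᵐ[volume] potential n α (f : SpaceTime n →ₘ[volume] ℝ) :=
  AEEqFun.coeFn_mk _ _

theorem vanishesBefore_iff {T : ℝ} {u : SpaceTime n →ₘ[volume] ℝ} :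
    VanishesBefore T u ↔ ∀ᵐ z, z ∈ slab n T → u z = 0 :=
  ae_restrict_iff' (measurableSet_slab n T)

theorem measurable_coe_X {p : ℝ} (f : X n p) : Measurable (f : SpaceTime n →ₘ[volume] ℝ) :=
  AEEqFun.measurable _

theorem vanishesBefore_J_iff {p α : ℝ} (h : Admissible n p α) (f : X n p) (T : ℝ) :
    VanishesBefore T (f : SpaceTime n →ₘ[volume] ℝ) ↔ VanishesBefore T (J n p α f) := by
  rw [vanishesBefore_iff, vanishesBefore_iff]
  constructor
  · intro hf
    filter_upwards [J_coeFn p α f] with z hz hzT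
    rw [hz, potential_eq_zero_of_ae_eq_zero α hf (le_of_lt hzT.2)]
  · intro hJ
    refine ae_eq_of_potential_ae_eq (f₂ := 0) h (measurable_coe_X f) measurable_const (f.2 T)
      MemLp.zero ?_
    filter_upwards [J_coeFn p α f, hJ] with z hz hz0 hzT
    rw [← hz, hz0 hzT]
    simp [potential]

theorem injective_J {p α : ℝ} (h : Admissible n p α) : Function.Injective (J n p α) := by
  intro f₁ f₂ hf
  have h1 : ∀ᵐ z, ∀ N : ℕ, z ∈ slab n N → (f₁ : SpaceTime n →ₘ[volume] ℝ) z =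
      (f₂ : SpaceTime n →ₘ[volume] ℝ) z := by
    refine ae_all_iff.2 fun N => ae_eq_of_potential_ae_eq h (measurable_coe_X f₁)
      (measurable_coe_X f₂) (f₁.2 N) (f₂.2 N) ?_
    filter_upwards [J_coeFn p α f₁, J_coeFn p α f₂] with z h₁ h₂ _
    rw [← h₁, ← h₂, hf]
  refine Subtype.ext (AEEqFun.ext ?_)
  filter_upwards [h1] with z hz
  obtain ⟨N, hN⟩ := exists_nat_gt z.2
  exact hz N ⟨mem_univ _, hN⟩

theorem bijective_JXY {p α : ℝ} (h : Admissible n p α) : Function.Bijective (JXY n p α) := by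
  refine ⟨fun f₁ f₂ hf => injective_J h (congrArg Subtype.val hf), ?_⟩
  rintro ⟨_, f, rfl⟩
  exact ⟨f, rfl⟩

end FracHeat

theorem theorem2p3 (n : ℕ) (hn : 1 ≤ n) (p α : ℝ)
    (hpα : (1 < p ∧ 0 < α ∧ α < ((n : ℝ) + 2) / (2 * p)) ∨
      (p = 1 ∧ 0 < α ∧ α ≤ ((n : ℝ) + 2) / (2 * p))) :
    (∀ f : FracHeat.X n p, ∀ᵐ z : FracHeat.SpaceTime n,
      MeasureTheory.IntegrableOn
        (fun w => FracHeat.Phi n α (z.1 - w.1) (z.2 - w.2) *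
          (f : FracHeat.SpaceTime n →ₘ[MeasureTheory.volume] ℝ) w)
        (FracHeat.slab n z.2) MeasureTheory.volume) ∧
    (Function.Injective (FracHeat.JXY n p α) ∧ Function.Surjective (FracHeat.JXY n p α)) ∧
    (∀ (f : FracHeat.X n p) (T : ℝ),
      FracHeat.VanishesBefore T (f : FracHeat.SpaceTime n →ₘ[MeasureTheory.volume] ℝ) ↔
        FracHeat.VanishesBefore T (FracHeat.J n p α f)) ∧
    (∃! D : FracHeat.Y n p α → FracHeat.X n p,
      Function.LeftInverse D (FracHeat.JXY n p α) ∧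
        Function.RightInverse D (FracHeat.JXY n p α)) := by
  have hb := FracHeat.bijective_JXY (n := n) hpα
  refine ⟨fun f => FracHeat.ae_integrableOn_Phi_mul hpα (FracHeat.measurable_coe_X f) f.2, hb,
    FracHeat.vanishesBefore_J_iff hpα, ?_⟩
  obtain ⟨D, hD⟩ := Function.bijective_iff_has_inverse.1 hb
  refine ⟨D, hD, fun D' hD' => ?_⟩
  ext1 y
  obtain ⟨f, rfl⟩ := hb.2 y
  rw [hD.1 f, hD'.1 f]
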